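/- Let $\Delta\subset\mathbb{R}^2$ be a Sierpiński triangle of side length $1$: start with a closed, filled-in equilateral triangle $\Delta_0$ of side length $1$; at each step replace every triangle by its three closed half-size triangles, one at each vertex (the other two vertices of each being the midpoints of the adjacent sides); let $\Delta_n$ be the union of the triangles obtained after $n$ steps, and put $\Delta=\bigcap_{n\ge 0}\Delta_n$. Let $0<\alpha\le 1$ and let $f:\Delta\to\mathbb{R}$ be a $1$-Hölder-$\alpha$ function, that is, $|f(x)-f(y)|\le |x-y|^{\alpha}$ for all $x,y\in\Delta$. Then for Lebesgue almost every $r\in f(\Delta)$, $$\dim_H\bigl(f^{-1}(r)\bigr)\ \ge\ \frac{\frac{\alpha}{2}}{1+\frac{1+\log\frac{3}{\alpha}}{\log 2}+\frac{2}{\alpha}}\ >\ 0,$$ where $\dim_H$ is the Hausdorff dimension and $\log$ the natural logarithm. -/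

import Mathlib

open scoped NNReal

/-- The `n`-th level triangles of the Sierpiński construction that starts with the triangle with
vertices `v 0, v 1, v 2`. A triangle is recorded by its three vertices; passing to the next level
replaces every triangle `T` by the three triangles of half the size at its vertices (the central
one is removed). -/
def sierpinskiTriangles (v : Fin 3 → EuclideanSpace ℝ (Fin 2)) :
    ℕ → Set (Fin 3 → EuclideanSpace ℝ (Fin 2))
  | 0 => {v}
  | n + 1 => {T' | ∃ T ∈ sierpinskiTriangles v n, ∃ i : Fin 3, T' = fun j => midpoint ℝ (T i) (T j)}

/-- The `n`-th approximation: the union of the closed, filled-in triangles of level `n`. -/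
def sierpinskiApprox (v : Fin 3 → EuclideanSpace ℝ (Fin 2)) (n : ℕ) :
    Set (EuclideanSpace ℝ (Fin 2)) :=
  ⋃ T ∈ sierpinskiTriangles v n, convexHull ℝ (Set.range T)

/-- The Sierpiński triangle with outer vertices `v 0, v 1, v 2`: the intersection of all the
approximations. -/
def sierpinskiTriangle (v : Fin 3 → EuclideanSpace ℝ (Fin 2)) :
    Set (EuclideanSpace ℝ (Fin 2)) :=
  ⋂ n, sierpinskiApprox v n

/-! Fix a value `r` not taken at any vertex and colour each vertex by the side of `r` on which `f`
lies there. A mixed triangle either has two mixed children, or has one that sits at an isolated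
vertex which stays isolated in the child (`exists_mixed_children`). While there is no choice the
same corner is repeated, so a descent through mixed triangles branches about once for every two
maximal blocks (runs) of equal letters in the address. Steering the branches by the binary digits of
`t` in `[0, 1)` gives points of the level set; parameters sharing a word with `m` runs are within
`O(2 ^ (-m / 2))` of each other (`exists_coding`).

For almost every `r` the runs are plentiful. A mixed triangle of level `n` confines `r` to a set of
measure at most `2 ^ (-α n)`, and few words have at most `2 c n` runs (`card_filter_letterRuns_le`),
so Borel–Cantelli leaves only mixed words with more than `2 c n` runs for large `n`
(`ae_eventually_lt_letterRuns`). The image of Lebesgue measure under the coding then gives mass `O(2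
^ (-c n))` to every set of diameter at most `2 ^ (-n)`, since such a set meets boundedly many
triangles of level `n`. The mass distribution principle yields dimension at least `c`; the stated
constant is an admissible `c` (`entropy_estimate`). -/

/-- The triangle with address `w`; the head of the list is the letter added last. -/
noncomputable def wordTriangle (v : Fin 3 → EuclideanSpace ℝ (Fin 2)) :
    List (Fin 3) → Fin 3 → EuclideanSpace ℝ (Fin 2)
  | [] => v
  | i :: w => fun j => midpoint ℝ (wordTriangle v w i) (wordTriangle v w j)

/-- The closed triangle with address `w`. -/
def wordHull (v : Fin 3 → EuclideanSpace ℝ (Fin 2)) (w : List (Fin 3)) :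
    Set (EuclideanSpace ℝ (Fin 2)) :=
  convexHull ℝ (Set.range (wordTriangle v w))

/-! ### Addresses, vertices and the lattice geometry of the triangles. -/

section Geometry

variable {v : Fin 3 → EuclideanSpace ℝ (Fin 2)}

theorem mem_sierpinskiTriangles {n : ℕ} {T : Fin 3 → EuclideanSpace ℝ (Fin 2)} :
    T ∈ sierpinskiTriangles v n ↔ ∃ w : List (Fin 3), w.length = n ∧ wordTriangle v w = T := by
  induction n generalizing T with
  | zero =>
    constructor
    · intro h
      exact ⟨[], rfl, (show T = v from h).symm⟩
    · rintro ⟨w, hw, rfl⟩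
      rw [List.length_eq_zero_iff] at hw
      subst hw
      rfl
  | succ n ih =>
    constructor
    · rintro ⟨T', hT', i, rfl⟩
      obtain ⟨w, hw, rfl⟩ := ih.1 hT'
      exact ⟨i :: w, by simp [hw], rfl⟩
    · rintro ⟨w, hw, rfl⟩
      cases w with
      | nil => simp at hw
      | cons i w => exact ⟨wordTriangle v w, ih.2 ⟨w, by simpa using hw, rfl⟩, i, rfl⟩

theorem mem_sierpinskiApprox {n : ℕ} {x : EuclideanSpace ℝ (Fin 2)} :
    x ∈ sierpinskiApprox v n ↔ ∃ w : List (Fin 3), w.length = n ∧ x ∈ wordHull v w := by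
  simp only [sierpinskiApprox, Set.mem_iUnion, mem_sierpinskiTriangles, wordHull]
  constructor
  · rintro ⟨T, ⟨w, hw, rfl⟩, hx⟩
    exact ⟨w, hw, hx⟩
  · rintro ⟨w, hw, hx⟩
    exact ⟨_, ⟨w, hw, rfl⟩, hx⟩

theorem wordTriangle_mem_wordHull (w : List (Fin 3)) (i : Fin 3) :
    wordTriangle v w i ∈ wordHull v w :=
  subset_convexHull ℝ _ (Set.mem_range_self i)

theorem wordTriangle_cons_self (w : List (Fin 3)) (i : Fin 3) :
    wordTriangle v (i :: w) i = wordTriangle v w i :=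
  midpoint_self ℝ _

theorem wordTriangle_cons_comm (w : List (Fin 3)) (i j : Fin 3) :
    wordTriangle v (i :: w) j = wordTriangle v (j :: w) i :=
  midpoint_comm _ _

theorem wordHull_cons_subset (w : List (Fin 3)) (i : Fin 3) :
    wordHull v (i :: w) ⊆ wordHull v w := by
  refine convexHull_min ?_ (convex_convexHull ℝ _)
  rintro _ ⟨j, rfl⟩
  exact (convex_convexHull ℝ _).midpoint_mem (wordTriangle_mem_wordHull w i)
    (wordTriangle_mem_wordHull w j)

theorem sierpinskiApprox_antitone : Antitone (sierpinskiApprox v) := by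
  refine antitone_nat_of_succ_le fun n x hx => ?_
  obtain ⟨w, hw, hx⟩ := mem_sierpinskiApprox.1 hx
  cases w with
  | nil => simp at hw
  | cons i w =>
    exact mem_sierpinskiApprox.2 ⟨w, by simpa using hw, wordHull_cons_subset w i hx⟩

theorem wordTriangle_mem_sierpinskiTriangle (w : List (Fin 3)) (i : Fin 3) :
    wordTriangle v w i ∈ sierpinskiTriangle v := by
  refine Set.mem_iInter.2 fun n => ?_
  -- Repeating the letter `i` shrinks the triangle towards its vertex `i`, which therefore survives
  -- at all levels.
  have h : ∀ k : ℕ, wordTriangle v (List.replicate k i ++ w) i = wordTriangle v w i := by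
    intro k
    induction k with
    | zero => rfl
    | succ k ih =>
      rw [List.replicate_succ, List.cons_append, wordTriangle_cons_self, ih]
  refine sierpinskiApprox_antitone (Nat.le_add_right n w.length)
    (mem_sierpinskiApprox.2 ⟨List.replicate n i ++ w, by simp, ?_⟩)
  rw [← h n]
  exact wordTriangle_mem_wordHull _ _

theorem wordTriangle_sub (w : List (Fin 3)) (i j : Fin 3) :
    wordTriangle v w j - wordTriangle v w i = (1 / 2 : ℝ) ^ w.length • (v j - v i) := by
  induction w generalizing i j with
  | nil => simp [wordTriangle]
  | cons k w ih =>
    have h : wordTriangle v (k :: w) j - wordTriangle v (k :: w) i =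
        (1 / 2 : ℝ) • (wordTriangle v w j - wordTriangle v w i) := by
      simp only [wordTriangle, midpoint_eq_smul_add, invOf_eq_inv]
      module
    rw [h, ih, List.length_cons, pow_succ', mul_smul]

theorem dist_wordTriangle_le (hv : ∀ i j, i ≠ j → dist (v i) (v j) = 1) (w : List (Fin 3))
    (i j : Fin 3) : dist (wordTriangle v w i) (wordTriangle v w j) ≤ (1 / 2 : ℝ) ^ w.length := by
  rw [dist_eq_norm, wordTriangle_sub, norm_smul, ← dist_eq_norm, norm_pow]
  have h : dist (v i) (v j) ≤ 1 := by
    by_cases hij : i = j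
    · simp [hij]
    · exact (hv i j hij).le
  have h2 : ‖(1 / 2 : ℝ)‖ = 1 / 2 := by norm_num
  rw [h2]
  exact mul_le_of_le_one_right (by positivity) h

theorem dist_le_of_mem_wordHull (hv : ∀ i j, i ≠ j → dist (v i) (v j) = 1) {w : List (Fin 3)}
    {x : EuclideanSpace ℝ (Fin 2)} (hx : x ∈ wordHull v w) (i : Fin 3) :
    dist x (wordTriangle v w i) ≤ (1 / 2 : ℝ) ^ w.length := by
  have h : wordHull v w ⊆ Metric.closedBall (wordTriangle v w i) ((1 / 2 : ℝ) ^ w.length) := by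
    refine convexHull_min ?_ (convex_closedBall _ _)
    rintro _ ⟨j, rfl⟩
    exact dist_wordTriangle_le hv w j i
  exact h hx

/-- Coordinates of the vertex `0` of the triangle with address `w` in the lattice of its level. -/
def latticeCoord (k : Fin 3) : List (Fin 3) → ℤ
  | [] => 0
  | i :: w => 2 * latticeCoord k w + if i = k then 1 else 0

theorem wordTriangle_zero_eq (w : List (Fin 3)) :
    wordTriangle v w 0 = v 0 + (1 / 2 : ℝ) ^ w.length •
      ((latticeCoord 1 w : ℝ) • (v 1 - v 0) + (latticeCoord 2 w : ℝ) • (v 2 - v 0)) := by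
  induction w with
  | nil => simp [wordTriangle, latticeCoord]
  | cons i w ih =>
    have h : wordTriangle v (i :: w) 0 = wordTriangle v w 0 +
        (1 / 2 : ℝ) • (wordTriangle v w i - wordTriangle v w 0) := by
      simp only [wordTriangle, midpoint_eq_smul_add, invOf_eq_inv]
      module
    rw [h, wordTriangle_sub, ih]
    fin_cases i <;> simp [latticeCoord] <;> module

/-- The parities of the two coordinates are (0,0), (1,0) or (0,1) and reveal the letter added last;
the rest follows by induction. -/
theorem eq_of_latticeCoord_eq {w w' : List (Fin 3)} (hl : w.length = w'.length)
    (h1 : latticeCoord 1 w = latticeCoord 1 w') (h2 : latticeCoord 2 w = latticeCoord 2 w') :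
    w = w' := by
  induction w generalizing w' with
  | nil => exact (List.length_eq_zero_iff.1 hl.symm).symm
  | cons i w ih =>
    cases w' with
    | nil => simp at hl
    | cons j w' =>
      have hl' : w.length = w'.length := by simpa using hl
      simp only [latticeCoord] at h1 h2
      have hij : i = j ∧ latticeCoord 1 w = latticeCoord 1 w' ∧
          latticeCoord 2 w = latticeCoord 2 w' := by
        fin_cases i <;> fin_cases j <;> simp at h1 h2 ⊢ <;> omega
      rw [hij.1, ih hl' hij.2.1 hij.2.2]

theorem norm_smul_add_smul_sq (hv : ∀ i j, i ≠ j → dist (v i) (v j) = 1) (a b : ℝ) :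
    ‖a • (v 1 - v 0) + b • (v 2 - v 0)‖ ^ 2 = a ^ 2 + a * b + b ^ 2 := by
  have h1 : ‖v 1 - v 0‖ = 1 := by rw [← dist_eq_norm]; exact hv _ _ (by decide)
  have h2 : ‖v 2 - v 0‖ = 1 := by rw [← dist_eq_norm]; exact hv _ _ (by decide)
  have h3 : ‖(v 1 - v 0) - (v 2 - v 0)‖ = 1 := by
    rw [sub_sub_sub_cancel_right, ← dist_eq_norm]; exact hv _ _ (by decide)
  have h4 := norm_sub_sq_real (v 1 - v 0) (v 2 - v 0)
  rw [h1, h2, h3] at h4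
  rw [norm_add_sq_real, norm_smul, norm_smul, h1, h2, real_inner_smul_left,
    real_inner_smul_right, mul_one, mul_one, Real.norm_eq_abs, Real.norm_eq_abs, sq_abs, sq_abs]
  linear_combination a * b * h4

/-- Bounds by a constant the number of triangles of one level that a set of comparable diameter can
meet: their base vertices are within three side lengths, and the lattice is discrete. -/
theorem abs_latticeCoord_sub_le (hv : ∀ i j, i ≠ j → dist (v i) (v j) = 1) {w w' : List (Fin 3)}
    (hl : w.length = w'.length) {x x' : EuclideanSpace ℝ (Fin 2)} (hx : x ∈ wordHull v w)
    (hx' : x' ∈ wordHull v w') (hxx : dist x x' ≤ (1 / 2 : ℝ) ^ w.length) :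
    |latticeCoord 1 w - latticeCoord 1 w'| ≤ 3 ∧ |latticeCoord 2 w - latticeCoord 2 w'| ≤ 3 := by
  set δ : ℝ := (1 / 2 : ℝ) ^ w.length with hδ
  have hδ0 : 0 < δ := by positivity
  have h1 := dist_le_of_mem_wordHull hv hx 0
  have h2 := dist_le_of_mem_wordHull hv hx' 0
  rw [← hl, ← hδ] at h2
  have h3 : dist (wordTriangle v w 0) (wordTriangle v w' 0) ≤ 3 * δ := by
    have := dist_triangle4 (wordTriangle v w 0) x x' (wordTriangle v w' 0)
    rw [dist_comm _ x] at this
    linarith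
  set a : ℤ := latticeCoord 1 w - latticeCoord 1 w' with ha
  set b : ℤ := latticeCoord 2 w - latticeCoord 2 w' with hb
  have h4 : wordTriangle v w 0 - wordTriangle v w' 0 =
      δ • ((a : ℝ) • (v 1 - v 0) + (b : ℝ) • (v 2 - v 0)) := by
    rw [wordTriangle_zero_eq w, wordTriangle_zero_eq w', ← hl, ← hδ, ha, hb]
    push_cast
    module
  rw [dist_eq_norm, h4, norm_smul, Real.norm_of_nonneg hδ0.le, mul_comm 3 δ] at h3
  have h5 := le_of_mul_le_mul_left h3 hδ0
  have h6 : (a : ℝ) ^ 2 + a * b + (b : ℝ) ^ 2 ≤ 9 := by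
    rw [← norm_smul_add_smul_sq hv]
    nlinarith [norm_nonneg ((a : ℝ) • (v 1 - v 0) + (b : ℝ) • (v 2 - v 0))]
  have h7 : a ^ 2 + a * b + b ^ 2 ≤ 9 := by exact_mod_cast h6
  -- Since `4 (a² + ab + b²) = 3 a² + (a + 2 b)²`, the bound gives `a² ≤ 12`, hence `|a| ≤ 3` for an
  -- integer; likewise for `b`.
  constructor
  · rw [abs_le]
    constructor <;> nlinarith [sq_nonneg (a + 2 * b)]
  · rw [abs_le]
    constructor <;> nlinarith [sq_nonneg (b + 2 * a)]

theorem isCompact_wordHull (w : List (Fin 3)) : IsCompact (wordHull v w) :=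
  (Set.finite_range _).isCompact_convexHull ℝ

/-- The triangles along an infinite address meet in a point of the Sierpiński triangle. -/
theorem exists_mem_wordHull_path {W : ℕ → List (Fin 3)}
    (hW : ∀ k, ∃ i, W (k + 1) = i :: W k) :
    ∃ x ∈ sierpinskiTriangle v, ∀ k, x ∈ wordHull v (W k) := by
  have hsub : ∀ k, wordHull v (W (k + 1)) ⊆ wordHull v (W k) := by
    intro k
    obtain ⟨i, hi⟩ := hW k
    rw [hi]
    exact wordHull_cons_subset _ _
  obtain ⟨x, hx⟩ := IsCompact.nonempty_iInter_of_sequence_nonempty_isCompact_isClosed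
    (fun k => wordHull v (W k)) hsub (fun k => ⟨_, wordTriangle_mem_wordHull (W k) 0⟩)
    (isCompact_wordHull _) (fun k => (isCompact_wordHull _).isClosed)
  rw [Set.mem_iInter] at hx
  have hlen : ∀ k, k ≤ (W k).length := by
    intro k
    induction k with
    | zero => exact Nat.zero_le _
    | succ k ih =>
      obtain ⟨i, hi⟩ := hW k
      rw [hi, List.length_cons]
      omega
  exact ⟨x, Set.mem_iInter.2 fun n =>
    sierpinskiApprox_antitone (hlen n) (mem_sierpinskiApprox.2 ⟨W n, rfl, hx n⟩), hx⟩

end Geometry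

/-! ### Counting words by their number of runs. -/

section Words

/-- The number of maximal blocks of equal letters in a word. -/
def letterRuns : List (Fin 3) → ℕ
  | [] => 0
  | i :: w => letterRuns w + if w.head? = some i then 0 else 1

/-- The finite set of all words of a given length. -/
def wordsOfLength : ℕ → Finset (List (Fin 3))
  | 0 => {[]}
  | n + 1 => (Finset.univ ×ˢ wordsOfLength n).image fun p => p.1 :: p.2

theorem mem_wordsOfLength {n : ℕ} {w : List (Fin 3)} : w ∈ wordsOfLength n ↔ w.length = n := by
  induction n generalizing w with
  | zero => simp [wordsOfLength, List.length_eq_zero_iff]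
  | succ n ih =>
    cases w with
    | nil => simp [wordsOfLength]
    | cons i w => simp [wordsOfLength, ih]

theorem sum_wordsOfLength_succ (n : ℕ) (F : List (Fin 3) → ℝ) :
    ∑ w ∈ wordsOfLength (n + 1), F w = ∑ i, ∑ w ∈ wordsOfLength n, F (i :: w) := by
  rw [wordsOfLength, Finset.sum_image, Finset.sum_product]
  rintro ⟨i, w⟩ - ⟨j, w'⟩ - h
  simpa using h

/-- Transfer argument for the run generating function: of the three possible next letters one
continues the run (weight 1) and two start a new one (weight `y`). -/
theorem sum_pow_letterRuns_cons (y : ℝ) (n : ℕ) (i : Fin 3) :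
    ∑ w ∈ wordsOfLength n, y ^ letterRuns (i :: w) = y * (1 + 2 * y) ^ n := by
  induction n generalizing i with
  | zero => simp [wordsOfLength, letterRuns]
  | succ n ih =>
    rw [sum_wordsOfLength_succ]
    have h : ∀ j : Fin 3, ∑ w ∈ wordsOfLength n, y ^ letterRuns (i :: j :: w) =
        (if j = i then 1 else y) * (y * (1 + 2 * y) ^ n) := by
      intro j
      rw [← ih j, Finset.mul_sum]
      refine Finset.sum_congr rfl fun w _ => ?_
      have h1 : letterRuns (i :: j :: w) = letterRuns (j :: w) + if j = i then 0 else 1 := by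
        rw [letterRuns]
        simp
      rw [h1]
      split_ifs <;> ring
    simp only [h]
    rw [← Finset.sum_mul, Fin.sum_univ_three, pow_succ]
    fin_cases i <;> simp <;> ring

theorem sum_pow_letterRuns_le {y : ℝ} (hy : 0 < y) (hy1 : y ≤ 1) (n : ℕ) :
    ∑ w ∈ wordsOfLength n, y ^ letterRuns w ≤ (1 + 2 * y) ^ n := by
  refine le_of_mul_le_mul_left ?_ hy
  rw [← sum_pow_letterRuns_cons y n 0, Finset.mul_sum]
  refine Finset.sum_le_sum fun w _ => ?_
  rw [← pow_succ']
  refine pow_le_pow_of_le_one hy.le hy1 ?_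
  rw [letterRuns]
  split_ifs <;> omega

/-- Few words have few letter changes. -/
theorem card_filter_letterRuns_le {y : ℝ} (hy : 0 < y) (hy1 : y ≤ 1) (n : ℕ) (b : ℝ) :
    (((wordsOfLength n).filter fun w => (letterRuns w : ℝ) ≤ b).card : ℝ) ≤
      y ^ (-b) * (1 + 2 * y) ^ n := by
  have h : (((wordsOfLength n).filter fun w => (letterRuns w : ℝ) ≤ b).card : ℝ) * y ^ b ≤
      (1 + 2 * y) ^ n := by
    refine le_trans ?_ (sum_pow_letterRuns_le hy hy1 n)
    rw [← nsmul_eq_mul]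
    refine le_trans (Finset.card_nsmul_le_sum _ (fun w => y ^ letterRuns w) _ ?_)
      (Finset.sum_le_sum_of_subset_of_nonneg (Finset.filter_subset _ _)
        fun w _ _ => by positivity)
    intro w hw
    rw [← Real.rpow_natCast]
    exact Real.rpow_le_rpow_of_exponent_ge hy hy1 (Finset.mem_filter.1 hw).2
  rw [Real.rpow_neg hy.le, inv_mul_eq_div, le_div_iff₀ (Real.rpow_pos_of_pos hy b)]
  exact h

end Words

/-! ### Descent through mixed triangles, coded by binary digits. -/

section Coding

/-- A two-colouring of the vertices of a triangle is nonconstant. -/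
def IsMixed (s : Fin 3 → Bool) : Prop := ∃ i j, s i ≠ s j

/-- The vertex `i` is the only one of its colour. -/
def IsIsolated (s : Fin 3 → Bool) (i : Fin 3) : Prop := ∀ j, j ≠ i → s j ≠ s i

instance (s : Fin 3 → Bool) : Decidable (IsMixed s) := by unfold IsMixed; infer_instance

instance (s : Fin 3 → Bool) (i : Fin 3) : Decidable (IsIsolated s i) := by
  unfold IsIsolated; infer_instance

theorem IsIsolated.eq {s : Fin 3 → Bool} {i j : Fin 3} (hi : IsIsolated s i)
    (hj : IsIsolated s j) : i = j := by
  revert s i j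
  decide

/-- Here `x`, `y`, `z` colour the midpoints opposite the vertices coloured `a`, `b`, `c`. The two
edges at the isolated vertex each change colour in one of their halves; unless both changes lie in
the child at that vertex, two children are mixed. If both do, that vertex is isolated in its child.
-/
theorem exists_mixed_children_aux : ∀ a b c x y z : Bool, IsMixed ![a, b, c] →
    ∃ i j : Fin 3, IsMixed (![![a, z, y], ![z, b, x], ![y, x, c]] i) ∧
      IsMixed (![![a, z, y], ![z, b, x], ![y, x, c]] j) ∧
      (i = j → IsIsolated ![a, b, c] i ∧
        IsIsolated (![![a, z, y], ![z, b, x], ![y, x, c]] i) i) := by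
  decide

variable {σ : List (Fin 3) → Fin 3 → Bool}

/-- A mixed triangle has two mixed children, or the only mixed child is at a vertex that is
isolated in both of them. -/
theorem exists_mixed_children (h1 : ∀ w i, σ (i :: w) i = σ w i)
    (h2 : ∀ w i j, σ (i :: w) j = σ (j :: w) i) (w : List (Fin 3)) (hw : IsMixed (σ w)) :
    ∃ c : Bool → Fin 3, (∀ b, IsMixed (σ (c b :: w))) ∧
      (c false = c true → IsIsolated (σ w) (c true) ∧
        IsIsolated (σ (c true :: w)) (c true)) := by
  have e : σ w = ![σ w 0, σ w 1, σ w 2] := by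
    ext i; fin_cases i <;> rfl
  have e' : ∀ i, σ (i :: w) = (![![σ w 0, σ (0 :: w) 1, σ (0 :: w) 2],
      ![σ (0 :: w) 1, σ w 1, σ (1 :: w) 2], ![σ (0 :: w) 2, σ (1 :: w) 2, σ w 2]] :
        Fin 3 → Fin 3 → Bool) i := by
    intro i
    ext j
    fin_cases i <;> fin_cases j <;> simp [h1, h2 w 1 0, h2 w 2 0, h2 w 2 1]
  rw [e] at hw
  obtain ⟨i, j, hi, hj, hij⟩ := exists_mixed_children_aux _ _ _ (σ (1 :: w) 2) (σ (0 :: w) 2)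
    (σ (0 :: w) 1) hw
  rw [← e'] at hi hj hij
  rw [← e] at hij
  refine ⟨fun b => if b then i else j, fun b => ?_, fun h => hij (by simpa using h.symm)⟩
  cases b
  · simpa using hj
  · simpa using hi

/-- One step of the coding: the current word is extended by the letter that the leading binary
digit selects; the digit is used up if there was a choice. -/
noncomputable def codeStep (c : List (Fin 3) → Bool → Fin 3) (p : List (Fin 3) × ℝ) :
    List (Fin 3) × ℝ :=
  (c p.1 (decide (1 / 2 ≤ p.2)) :: p.1,
    if c p.1 false = c p.1 true then p.2 else if 1 / 2 ≤ p.2 then 2 * p.2 - 1 else 2 * p.2)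

/-- `1` if the last letter of the word is not an isolated vertex of its triangle. -/
noncomputable def isolationDefect (σ : List (Fin 3) → Fin 3 → Bool) (w : List (Fin 3)) : ℕ :=
  open Classical in if ∃ i, w.head? = some i ∧ IsIsolated (σ w) i then 0 else 1

theorem isolationDefect_le_one (w : List (Fin 3)) : isolationDefect σ w ≤ 1 := by
  unfold isolationDefect
  split_ifs <;> omega

theorem letterRuns_cons_le (w : List (Fin 3)) (i : Fin 3) :
    letterRuns (i :: w) ≤ letterRuns w + 1 := by
  rw [letterRuns]
  split_ifs <;> omega

/-- A forced step costs nothing in the potential. If it starts a new run, the previous letter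
differs from the unique isolated vertex, so the old defect was 1 and pays for the run. -/
theorem letterRuns_cons_add_isolationDefect_le {w : List (Fin 3)} {i : Fin 3}
    (hi : IsIsolated (σ w) i) (hi' : IsIsolated (σ (i :: w)) i) :
    letterRuns (i :: w) + isolationDefect σ (i :: w) ≤ letterRuns w + isolationDefect σ w := by
  have h : isolationDefect σ (i :: w) = 0 := by
    unfold isolationDefect
    rw [if_pos ⟨i, rfl, hi'⟩]
  rw [h, letterRuns]
  split_ifs with hh
  · omega
  · have h' : isolationDefect σ w = 1 := by
      unfold isolationDefect
      refine if_neg ?_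
      rintro ⟨j, hj, hj'⟩
      exact hh (by rw [hj, hj'.eq hi])
    omega

/-- Runs plus defect serve as a potential: a branching step raises it by at most 2 and doubles the
distance of the remaining parameters, a forced step does not raise it. This is why the distance
appears squared. -/
theorem exists_coding (h1 : ∀ w i, σ (i :: w) i = σ w i)
    (h2 : ∀ w i j, σ (i :: w) j = σ (j :: w) i) {u : List (Fin 3)} (hu : IsMixed (σ u)) :
    ∃ W : ℝ → ℕ → List (Fin 3), (∀ t, W t 0 = u) ∧ (∀ t k, ∃ i, W t (k + 1) = i :: W t k) ∧
      (∀ t k, IsMixed (σ (W t k))) ∧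
      ∀ t ∈ Set.Ico (0 : ℝ) 1, ∀ t' ∈ Set.Ico (0 : ℝ) 1, ∀ k, W t k = W t' k →
        (t - t') ^ 2 * 2 ^ letterRuns (W t k) ≤ 2 ^ (letterRuns u + 1) := by
  have hex : ∀ w, ∃ c : Bool → Fin 3, IsMixed (σ w) → (∀ b, IsMixed (σ (c b :: w))) ∧
      (c false = c true → IsIsolated (σ w) (c true) ∧
        IsIsolated (σ (c true :: w)) (c true)) := by
    intro w
    by_cases hw : IsMixed (σ w)
    · obtain ⟨c, hc⟩ := exists_mixed_children h1 h2 w hw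
      exact ⟨c, fun _ => hc⟩
    -- An arbitrary value: the descent never leaves mixed words.
    · exact ⟨fun _ => 0, fun h => absurd h hw⟩
  choose c hc using hex
  let P : ℝ → ℕ → List (Fin 3) × ℝ := fun t k => (codeStep c)^[k] (u, t)
  have hP : ∀ t k, P t (k + 1) = codeStep c (P t k) := fun t k =>
    Function.iterate_succ_apply' _ _ _
  have hmix : ∀ t k, IsMixed (σ (P t k).1) := by
    intro t k
    induction k with
    | zero => exact hu
    | succ k ih =>
      rw [hP]
      exact (hc _ ih).1 _
  have hIco : ∀ t ∈ Set.Ico (0 : ℝ) 1, ∀ k, (P t k).2 ∈ Set.Ico (0 : ℝ) 1 := by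
    intro t ht k
    induction k with
    | zero => exact ht
    | succ k ih =>
      rw [hP]
      obtain ⟨h0, h1⟩ := ih
      simp only [codeStep]
      split_ifs
      · exact ⟨h0, h1⟩
      · constructor <;> linarith
      · constructor <;> linarith
  have key : ∀ t t' k, (P t k).1 = (P t' k).1 →
      (t - t') ^ 2 * 2 ^ (letterRuns (P t k).1 + isolationDefect σ (P t k).1) ≤
        2 ^ (letterRuns u + 1) * ((P t k).2 - (P t' k).2) ^ 2 := by
    intro t t' k
    induction k with
    | zero =>
      intro _
      have : P t 0 = (u, t) := rfl
      rw [this]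
      have : P t' 0 = (u, t') := rfl
      rw [this, mul_comm]
      refine mul_le_mul_of_nonneg_right (pow_le_pow_right₀ (by norm_num) ?_) (sq_nonneg _)
      exact Nat.add_le_add_left (isolationDefect_le_one u) _
    | succ k ih =>
      rw [hP, hP]
      intro heq
      have hw : (P t k).1 = (P t' k).1 := (List.cons_eq_cons.1 heq).2
      have hl := (List.cons_eq_cons.1 heq).1
      have ih := ih hw
      rw [← hw] at hl
      by_cases hbr : c (P t k).1 false = c (P t k).1 true
      · have hb : ∀ b, c (P t k).1 b = c (P t k).1 true := by
          intro b
          cases b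
          · exact hbr
          · rfl
        have hx : (codeStep c (P t k)).2 = (P t k).2 := if_pos hbr
        have hx' : (codeStep c (P t' k)).2 = (P t' k).2 := if_pos (hw ▸ hbr)
        have hs : (codeStep c (P t k)).1 = c (P t k).1 true :: (P t k).1 := by
          rw [← hb (decide (1 / 2 ≤ (P t k).2))]
          rfl
        rw [hx, hx', hs]
        refine le_trans (mul_le_mul_of_nonneg_left (pow_le_pow_right₀ (by norm_num) ?_)
          (sq_nonneg _)) ih
        obtain ⟨hi, hi'⟩ := (hc _ (hmix t k)).2 hbr
        exact letterRuns_cons_add_isolationDefect_le hi hi'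
      -- The two options differ here, so equal new letters mean equal digits.
      · have hd : (1 / 2 ≤ (P t k).2) ↔ (1 / 2 ≤ (P t' k).2) := by
          by_cases p : 1 / 2 ≤ (P t k).2 <;> by_cases q : 1 / 2 ≤ (P t' k).2
          · exact iff_of_true p q
          · simp only [p, q, decide_true, decide_false] at hl
            exact absurd hl.symm hbr
          · simp only [p, q, decide_true, decide_false] at hl
            exact absurd hl hbr
          · exact iff_of_false p q
        have hx : ((codeStep c (P t k)).2 - (codeStep c (P t' k)).2) =
            2 * ((P t k).2 - (P t' k).2) := by
          simp only [codeStep, ← hw, if_neg hbr, ← hd]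
          split_ifs <;> ring
        have hs : letterRuns (codeStep c (P t k)).1 + isolationDefect σ (codeStep c (P t k)).1 ≤
            letterRuns (P t k).1 + isolationDefect σ (P t k).1 + 2 := by
          have a1 := letterRuns_cons_le (P t k).1 (c (P t k).1 (decide (1 / 2 ≤ (P t k).2)))
          have a2 := isolationDefect_le_one (σ := σ) (codeStep c (P t k)).1
          have a3 : (codeStep c (P t k)).1 =
            c (P t k).1 (decide (1 / 2 ≤ (P t k).2)) :: (P t k).1 := rfl
          rw [← a3] at a1
          omega
        rw [hx]
        calc _ ≤ (t - t') ^ 2 * 2 ^ (letterRuns (P t k).1 + isolationDefect σ (P t k).1 + 2) :=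
              mul_le_mul_of_nonneg_left (pow_le_pow_right₀ (by norm_num) hs) (sq_nonneg _)
          _ = 4 * ((t - t') ^ 2 * 2 ^ (letterRuns (P t k).1 + isolationDefect σ (P t k).1)) := by
              rw [pow_add]; ring
          _ ≤ 4 * (2 ^ (letterRuns u + 1) * ((P t k).2 - (P t' k).2) ^ 2) := by gcongr
          _ = _ := by ring
  refine ⟨fun t k => (P t k).1, fun t => rfl, fun t k => ⟨_, congrArg Prod.fst (hP t k)⟩, hmix, ?_⟩
  intro t ht t' ht' k hk
  have h3 := key t t' k hk
  have h4 : ((P t k).2 - (P t' k).2) ^ 2 ≤ 1 := by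
    obtain ⟨a, b⟩ := hIco t ht k
    obtain ⟨a', b'⟩ := hIco t' ht' k
    rw [sq_le_one_iff_abs_le_one, abs_le]
    constructor <;> linarith
  calc (t - t') ^ 2 * 2 ^ letterRuns (P t k).1
      ≤ (t - t') ^ 2 * 2 ^ (letterRuns (P t k).1 + isolationDefect σ (P t k).1) :=
        mul_le_mul_of_nonneg_left (pow_le_pow_right₀ (by norm_num) (Nat.le_add_right _ _))
          (sq_nonneg _)
    _ ≤ _ := h3
    _ ≤ 2 ^ (letterRuns u + 1) * 1 := by gcongr
    _ = _ := mul_one _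

end Coding

/-! ### A mass distribution principle. -/

section MassDistribution

open MeasureTheory Metric Filter Topology
open scoped ENNReal

/-- The mass distribution principle for the image of Lebesgue measure under a map that need not be
measurable. -/
theorem le_dimH_of_volume_preimage_le {X : Type*} [EMetricSpace X] {K : Set X} {φ : ℝ → X}
    (hφ : ∀ t ∈ Set.Ico (0 : ℝ) 1, φ t ∈ K) {c : ℝ≥0} (hc : 0 < c) {C : ℝ≥0} {n₀ : ℕ}
    (h : ∀ n, n₀ ≤ n → ∀ s : Set X, ediam s ≤ (1 / 2 : ℝ≥0∞) ^ n →
      volume (φ ⁻¹' s ∩ Set.Ico 0 1) ≤ C * ((1 / 2 : ℝ≥0∞) ^ n) ^ (c : ℝ)) :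
    (c : ℝ≥0∞) ≤ dimH K := by
  borelize X
  refine le_dimH_of_hausdorffMeasure_ne_zero ?_
  let m : OuterMeasure X := OuterMeasure.map φ (volume.restrict (Set.Ico (0 : ℝ) 1)).toOuterMeasure
  have hm : ∀ s, m s = volume (φ ⁻¹' s ∩ Set.Ico 0 1) := fun s =>
    Measure.restrict_apply' measurableSet_Ico
  have hmK : m K = 1 := by
    have : φ ⁻¹' K ∩ Set.Ico (0 : ℝ) 1 = Set.Ico 0 1 := Set.inter_eq_right.2 hφ
    rw [hm, this]
    simp
  -- The factor `2 ^ c` pays for rounding a positive diameter up to a power of `1 / 2`; sets of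
  -- diameter zero are handled by letting `n` tend to infinity.
  set D : ℝ≥0∞ := C * 2 ^ (c : ℝ) with hD
  have hDtop : D ≠ ∞ := by
    rw [hD]
    exact ENNReal.mul_ne_top ENNReal.coe_ne_top (ENNReal.rpow_ne_top_of_nonneg c.2 (by simp))
  have hc' : (0 : ℝ) < c := hc
  have hle : ∀ s : Set X, ediam s ≤ (1 / 2 : ℝ≥0∞) ^ n₀ → m s ≤ D * ediam s ^ (c : ℝ) := by
    intro s hs
    rw [hm]
    have hlim : Tendsto (fun n : ℕ => (1 / 2 : ℝ≥0∞) ^ n) atTop (𝓝 0) :=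
      ENNReal.tendsto_pow_atTop_nhds_zero_of_lt_one (by simp)
    by_cases h0 : ediam s = 0
    · have hlim2 : Tendsto (fun n : ℕ => (C : ℝ≥0∞) * ((1 / 2 : ℝ≥0∞) ^ n) ^ (c : ℝ)) atTop
          (𝓝 0) :=
        (ENNReal.tendsto_const_mul_rpow_nhds_zero_of_pos ENNReal.coe_ne_top hc').comp hlim
      refine le_trans (ge_of_tendsto hlim2 ?_) (zero_le)
      filter_upwards [eventually_ge_atTop n₀] with n hn
      exact h n hn s (by rw [h0]; exact zero_le)
    · have hle1 : ediam s ≤ 1 := hs.trans (pow_le_one₀ (zero_le) (by simp))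
      have hfin : ediam s ≠ ∞ := ne_top_of_le_ne_top ENNReal.one_ne_top hle1
      have hpos : 0 < (ediam s).toReal := ENNReal.toReal_pos h0 hfin
      have hle1' : (ediam s).toReal ≤ 1 := ENNReal.toReal_le_of_le_ofReal zero_le_one (by simpa)
      obtain ⟨n, hn1, hn2⟩ := exists_nat_pow_near_of_lt_one hpos hle1'
        (show (0 : ℝ) < 1 / 2 by norm_num) (by norm_num)
      have hpow : ∀ k : ℕ, ((1 / 2 : ℝ≥0∞) ^ k).toReal = (1 / 2 : ℝ) ^ k := by
        intro k
        simp
      have hpt : ∀ k : ℕ, (1 / 2 : ℝ≥0∞) ^ k ≠ ∞ := fun k => ENNReal.pow_ne_top (by simp)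
      rw [← hpow, ENNReal.toReal_lt_toReal (hpt _) hfin] at hn1
      rw [← hpow, ENNReal.toReal_le_toReal hfin (hpt _)] at hn2
      have hn : n₀ ≤ n := by
        by_contra! hlt
        refine absurd (hn1.trans_le hs) (not_lt.2 ?_)
        exact pow_le_pow_of_le_one (zero_le) (by simp) hlt
      refine (h n hn s hn2).trans ?_
      rw [hD, mul_assoc, ← ENNReal.mul_rpow_of_nonneg _ _ hc'.le]
      gcongr
      calc (1 / 2 : ℝ≥0∞) ^ n = 2 * (1 / 2 : ℝ≥0∞) ^ (n + 1) := by
            rw [pow_succ', ← mul_assoc, one_div, ENNReal.mul_inv_cancel (by simp) (by simp),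
              one_mul]
        _ ≤ 2 * ediam s := by gcongr
  have hmle : D⁻¹ • m ≤ OuterMeasure.mkMetric fun d : ℝ≥0∞ => d ^ (c : ℝ) := by
    refine OuterMeasure.le_mkMetric _ _ ((1 / 2 : ℝ≥0∞) ^ n₀) (ENNReal.pow_pos (by simp) _) ?_
    intro s hs
    have h3 : (D⁻¹ • m) s = D⁻¹ * m s := rfl
    rw [h3]
    calc D⁻¹ * m s ≤ D⁻¹ * (D * ediam s ^ (c : ℝ)) := by gcongr; exact hle s hs
      _ = (D⁻¹ * D) * ediam s ^ (c : ℝ) := (mul_assoc _ _ _).symm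
      _ ≤ 1 * ediam s ^ (c : ℝ) := by gcongr; exact ENNReal.inv_mul_le_one D
      _ = _ := one_mul _
  have h4 : D⁻¹ ≤ Measure.hausdorffMeasure (c : ℝ) K := by
    have h5 := hmle K
    have h6 : (D⁻¹ • m) K = D⁻¹ * m K := rfl
    rw [h6, hmK, mul_one, OuterMeasure.coe_mkMetric] at h5
    exact h5
  intro h7
  rw [h7] at h4
  exact hDtop (ENNReal.inv_eq_zero.1 (le_antisymm h4 (zero_le)))

end MassDistribution

/-! ### Generic values and the dimension of their level sets. -/

section LevelSets

open MeasureTheory Metric Filter Topology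
open scoped ENNReal

variable {v : Fin 3 → EuclideanSpace ℝ (Fin 2)} {F : EuclideanSpace ℝ (Fin 2) → ℝ} {α : ℝ≥0}

theorem tendsto_half_pow_rpow {a : ℝ} (ha : 0 < a) :
    Tendsto (fun n : ℕ => ((1 / 2 : ℝ) ^ n) ^ a) atTop (𝓝 0) := by
  have h := (tendsto_pow_atTop_nhds_zero_of_lt_one (show (0 : ℝ) ≤ 1 / 2 by norm_num)
    (by norm_num)).rpow_const (Or.inr ha.le)
  rwa [Real.zero_rpow ha.ne'] at h

theorem abs_sub_wordTriangle_le (hv : ∀ i j, i ≠ j → dist (v i) (v j) = 1)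
    (hF : HolderOnWith 1 α F (sierpinskiTriangle v)) {w : List (Fin 3)}
    {x : EuclideanSpace ℝ (Fin 2)} (hx : x ∈ sierpinskiTriangle v) (hxw : x ∈ wordHull v w)
    (i : Fin 3) : |F x - F (wordTriangle v w i)| ≤ ((1 / 2 : ℝ) ^ w.length) ^ (α : ℝ) := by
  have h := hF.dist_le hx (wordTriangle_mem_sierpinskiTriangle w i)
  rw [NNReal.coe_one, one_mul, Real.dist_eq] at h
  exact h.trans (Real.rpow_le_rpow dist_nonneg (dist_le_of_mem_wordHull hv hxw i) α.2)

/-- Vertices are dense in the Sierpiński triangle, and the Hölder bound carries the inequality to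
the limit. -/
theorem le_of_forall_wordTriangle_le (hv : ∀ i j, i ≠ j → dist (v i) (v j) = 1) (hα : 0 < α)
    (hF : HolderOnWith 1 α F (sierpinskiTriangle v)) {r : ℝ}
    (h : ∀ w i, F (wordTriangle v w i) ≤ r) {x : EuclideanSpace ℝ (Fin 2)}
    (hx : x ∈ sierpinskiTriangle v) : F x ≤ r := by
  have h1 : ∀ n : ℕ, F x - r ≤ ((1 / 2 : ℝ) ^ n) ^ (α : ℝ) := by
    intro n
    obtain ⟨w, rfl, hw⟩ := mem_sierpinskiApprox.1 (Set.mem_iInter.1 hx n)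
    have := (abs_le.1 (abs_sub_wordTriangle_le hv hF hx hw 0)).2
    linarith [h w 0]
  linarith [ge_of_tendsto' (tendsto_half_pow_rpow (a := α) hα) h1]

theorem HolderOnWith.neg {s : Set (EuclideanSpace ℝ (Fin 2))} (hF : HolderOnWith 1 α F s) :
    HolderOnWith 1 α (fun x => -F x) s := fun x hx y hy => by
  simpa only [edist_neg_neg] using hF x hx y hy

/-- The values that lie strictly between two values at the vertices of the triangle of address
`w`. -/
def straddledValues (v : Fin 3 → EuclideanSpace ℝ (Fin 2)) (F : EuclideanSpace ℝ (Fin 2) → ℝ)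
    (w : List (Fin 3)) : Set ℝ :=
  {r | ∃ i j, F (wordTriangle v w i) < r ∧ r < F (wordTriangle v w j)}

theorem volume_straddledValues_le (hv : ∀ i j, i ≠ j → dist (v i) (v j) = 1)
    (hF : HolderOnWith 1 α F (sierpinskiTriangle v)) (w : List (Fin 3)) :
    volume (straddledValues v F w) ≤ ENNReal.ofReal (((1 / 2 : ℝ) ^ w.length) ^ (α : ℝ)) := by
  refine (Real.volume_le_diam _).trans (ediam_le ?_)
  rintro r ⟨i, j, h1, h2⟩ r' ⟨i', j', h3, h4⟩
  rw [edist_dist, Real.dist_eq]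
  refine ENNReal.ofReal_le_ofReal ?_
  have a1 := (abs_le.1 (abs_sub_wordTriangle_le hv hF (wordTriangle_mem_sierpinskiTriangle w j)
    (wordTriangle_mem_wordHull w j) i')).2
  have a2 := (abs_le.1 (abs_sub_wordTriangle_le hv hF (wordTriangle_mem_sierpinskiTriangle w j')
    (wordTriangle_mem_wordHull w j') i)).2
  rw [abs_le]
  constructor <;> linarith

/-- For almost every value, the addresses of all small triangles that straddle it have many letter
changes. -/
theorem ae_eventually_lt_letterRuns (hv : ∀ i j, i ≠ j → dist (v i) (v j) = 1)
    (hF : HolderOnWith 1 α F (sierpinskiTriangle v)) {c y : ℝ} (hy : 0 < y) (hy1 : y ≤ 1)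
    (hlt : (1 + 2 * y) * y ^ (-(2 * c)) * (1 / 2 : ℝ) ^ (α : ℝ) < 1) :
    ∀ᵐ r : ℝ, ∀ᶠ n : ℕ in atTop, ∀ w : List (Fin 3), w.length = n →
      r ∈ straddledValues v F w → 2 * c * n < letterRuns w := by
  set ρ : ℝ := (1 + 2 * y) * y ^ (-(2 * c)) * (1 / 2 : ℝ) ^ (α : ℝ) with hρ
  have hρ0 : 0 ≤ ρ := by positivity
  let S : ℕ → Finset (List (Fin 3)) := fun n =>
    (wordsOfLength n).filter fun w => (letterRuns w : ℝ) ≤ 2 * c * n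
  have hvol : ∀ n, volume (⋃ w ∈ S n, straddledValues v F w) ≤ ENNReal.ofReal (ρ ^ n) := by
    intro n
    have hρn : (y ^ (-(2 * c * n)) * (1 + 2 * y) ^ n) * ((1 / 2 : ℝ) ^ n) ^ (α : ℝ) = ρ ^ n := by
      have e1 : y ^ (-(2 * c * n)) = (y ^ (-(2 * c))) ^ n := by
        rw [← Real.rpow_mul_natCast hy.le]
        ring_nf
      have e2 : ((1 / 2 : ℝ) ^ n) ^ (α : ℝ) = ((1 / 2 : ℝ) ^ (α : ℝ)) ^ n := by
        rw [← Real.rpow_mul_natCast (by norm_num), ← Real.rpow_natCast_mul (by norm_num), mul_comm]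
      rw [e1, e2, hρ, mul_pow, mul_pow]
      ring
    calc volume (⋃ w ∈ S n, straddledValues v F w)
        ≤ ∑ w ∈ S n, volume (straddledValues v F w) := measure_biUnion_finset_le _ _
      _ ≤ ∑ w ∈ S n, ENNReal.ofReal (((1 / 2 : ℝ) ^ n) ^ (α : ℝ)) := by
          refine Finset.sum_le_sum fun w hw => ?_
          rw [← mem_wordsOfLength.1 (Finset.mem_filter.1 hw).1]
          exact volume_straddledValues_le hv hF w
      _ = ENNReal.ofReal ((S n).card * ((1 / 2 : ℝ) ^ n) ^ (α : ℝ)) := by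
          rw [Finset.sum_const, nsmul_eq_mul, ENNReal.ofReal_mul (Nat.cast_nonneg _),
            ENNReal.ofReal_natCast]
      _ ≤ ENNReal.ofReal (ρ ^ n) := by
          refine ENNReal.ofReal_le_ofReal ?_
          rw [← hρn]
          exact mul_le_mul_of_nonneg_right (card_filter_letterRuns_le hy hy1 n _) (by positivity)
  have hsum : ∑' n, volume (⋃ w ∈ S n, straddledValues v F w) ≠ ∞ :=
    ne_top_of_le_ne_top (summable_geometric_of_lt_one hρ0 hlt).tsum_ofReal_ne_top
      (ENNReal.tsum_le_tsum hvol)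
  filter_upwards [ae_eventually_notMem hsum] with r hr
  filter_upwards [hr] with n hn w hw hrw
  by_contra! hle
  refine hn (Set.mem_iUnion₂.2 ⟨w, ?_, hrw⟩)
  exact Finset.mem_filter.2 ⟨mem_wordsOfLength.2 hw, hle⟩

/-- Taking the square root of `2 ^ (-m)` turns `m > 2 c n` into the rate `2 ^ (-c n)`; `1 ≤ A`
allows `A` in place of its root. -/
theorem abs_sub_le_of_letterRuns {t A c : ℝ} {m n : ℕ} (hA : 1 ≤ A)
    (h : t ^ 2 * 2 ^ m ≤ A) (hm : 2 * c * n < m) :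
    |t| ≤ A * ((1 / 2 : ℝ) ^ n) ^ c := by
  set x : ℝ := ((1 / 2 : ℝ) ^ n) ^ c with hx
  have hx0 : 0 < x := by positivity
  have h1 : 1 ≤ x ^ 2 * 2 ^ m := by
    have e1 : x ^ 2 * 2 ^ m = (2 : ℝ) ^ ((m : ℝ) - 2 * c * n) := by
      rw [hx, one_div, inv_pow, Real.inv_rpow (by positivity), ← Real.rpow_natCast_mul (by norm_num),
        ← Real.rpow_neg (by norm_num), ← Real.rpow_mul_natCast (by norm_num), ← Real.rpow_natCast,
        ← Real.rpow_add (by norm_num)]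
      congr 1
      push_cast
      ring
    rw [e1]
    exact Real.one_le_rpow (by norm_num) (by linarith)
  have h2 : t ^ 2 ≤ (A * x) ^ 2 := by
    calc t ^ 2 ≤ t ^ 2 * (x ^ 2 * 2 ^ m) := le_mul_of_one_le_right (sq_nonneg _) h1
      _ = (t ^ 2 * 2 ^ m) * x ^ 2 := by ring
      _ ≤ A * x ^ 2 := by gcongr
      _ ≤ A ^ 2 * x ^ 2 := by gcongr; nlinarith
      _ = _ := by ring
  exact abs_le_of_sq_le_sq h2 (by positivity)

/-- The vertex colouring of the triangles by the side of `r` on which the value lies. -/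
noncomputable def sideColouring (v : Fin 3 → EuclideanSpace ℝ (Fin 2))
    (F : EuclideanSpace ℝ (Fin 2) → ℝ) (r : ℝ) (w : List (Fin 3)) (i : Fin 3) : Bool :=
  decide (F (wordTriangle v w i) < r)

theorem mem_straddledValues_of_isMixed {r : ℝ} (hr : ∀ w i, F (wordTriangle v w i) ≠ r)
    {w : List (Fin 3)} (hw : IsMixed (sideColouring v F r w)) : r ∈ straddledValues v F w := by
  obtain ⟨i, j, hij⟩ := hw
  simp only [sideColouring, ne_eq, decide_eq_decide] at hij
  rcases lt_or_gt_of_ne (hr w i) with h | h <;> rcases lt_or_gt_of_ne (hr w j) with h' | h'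
  · exact absurd (iff_of_true h h') hij
  · exact ⟨i, j, h, h'⟩
  · exact ⟨j, i, h', h⟩
  · exact absurd (iff_of_false h.not_gt h'.not_gt) hij

theorem sideColouring_cons_self (r : ℝ) (w : List (Fin 3)) (i : Fin 3) :
    sideColouring v F r (i :: w) i = sideColouring v F r w i := by
  rw [sideColouring, wordTriangle_cons_self, sideColouring]

theorem sideColouring_cons_comm (r : ℝ) (w : List (Fin 3)) (i j : Fin 3) :
    sideColouring v F r (i :: w) j = sideColouring v F r (j :: w) i := by
  rw [sideColouring, wordTriangle_cons_comm, sideColouring]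

theorem volume_setOf_mem_word_le {u : List (Fin 3)} {W : ℝ → ℕ → List (Fin 3)} {T : Set ℝ}
    (hW : ∀ t ∈ T, ∀ t' ∈ T, ∀ k, W t k = W t' k →
      (t - t') ^ 2 * 2 ^ letterRuns (W t k) ≤ 2 ^ (letterRuns u + 1)) {c : ℝ} {k n : ℕ}
    (hn : ∀ t, 2 * c * n < letterRuns (W t k)) {B : Set ℝ} (hB : B ⊆ T)
    (hBW : ∀ t ∈ B, ∀ t' ∈ B, W t k = W t' k) :
    volume B ≤ ENNReal.ofReal (2 ^ (letterRuns u + 1) * ((1 / 2 : ℝ) ^ n) ^ c) := by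
  refine (Real.volume_le_diam _).trans (ediam_le fun t ht t' ht' => ?_)
  rw [edist_dist, Real.dist_eq]
  exact ENNReal.ofReal_le_ofReal (abs_sub_le_of_letterRuns (one_le_pow₀ (by norm_num))
    (hW t (hB ht) t' (hB ht') k (hBW t ht t' ht')) (hn t))

theorem le_dimH_level_set (hv : ∀ i j, i ≠ j → dist (v i) (v j) = 1) (hα : 0 < α)
    (hF : HolderOnWith 1 α F (sierpinskiTriangle v)) {r : ℝ}
    (hr : ∀ w i, F (wordTriangle v w i) ≠ r) {u : List (Fin 3)}
    (hu : IsMixed (sideColouring v F r u)) {c : ℝ≥0} (hc : 0 < c)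
    (hlim : ∀ᶠ n : ℕ in atTop, ∀ w : List (Fin 3), w.length = n →
      r ∈ straddledValues v F w → 2 * (c : ℝ) * n < letterRuns w) :
    (c : ℝ≥0∞) ≤ dimH {x | x ∈ sierpinskiTriangle v ∧ F x = r} := by
  obtain ⟨W, hW0, hWs, hWm, hWd⟩ := exists_coding (sideColouring_cons_self r)
    (sideColouring_cons_comm r) hu
  have hlen : ∀ t k, (W t k).length = u.length + k := by
    intro t k
    induction k with
    | zero => rw [hW0, add_zero]
    | succ k ih =>
      obtain ⟨i, hi⟩ := hWs t k
      rw [hi, List.length_cons, ih, add_assoc]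
  choose φ hφ hφW using fun t => exists_mem_wordHull_path (v := v) (hWs t)
  have hφr : ∀ t, F (φ t) = r := by
    intro t
    have h1 : ∀ k : ℕ, |F (φ t) - r| ≤ ((1 / 2 : ℝ) ^ (k + u.length)) ^ (α : ℝ) := by
      intro k
      obtain ⟨i, j, h2, h3⟩ := mem_straddledValues_of_isMixed hr (hWm t k)
      have a1 := (abs_le.1 (abs_sub_wordTriangle_le hv hF (hφ t) (hφW t k) i)).2
      have a2 := (abs_le.1 (abs_sub_wordTriangle_le hv hF (hφ t) (hφW t k) j)).1
      rw [hlen, add_comm] at a1 a2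
      rw [abs_le]
      constructor <;> linarith
    have h4 := ge_of_tendsto'
      ((tendsto_half_pow_rpow (a := α) hα).comp (tendsto_add_atTop_nat u.length)) h1
    have h5 := abs_nonpos_iff.1 h4
    linarith
  obtain ⟨N, hN⟩ := eventually_atTop.1 hlim
  set A : ℝ := 2 ^ (letterRuns u + 1) with hA
  have hA0 : 0 ≤ A := by positivity
  -- `49 = 7 * 7` counts the pairs of coordinate differences in `[-3, 3]`. Scales start where the
  -- run bound holds and words extend `u`.
  refine le_dimH_of_volume_preimage_le (φ := φ) (C := 49 * A.toNNReal) (n₀ := max N u.length)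
    (fun t _ => show φ t ∈ {x | x ∈ sierpinskiTriangle v ∧ F x = r} from ⟨hφ t, hφr t⟩) hc ?_
  intro n hn s hs
  rcases Set.eq_empty_or_nonempty (φ ⁻¹' s ∩ Set.Ico 0 1) with h0 | ⟨t₀, ht₀, -⟩
  · rw [h0]
    simp
  obtain ⟨k, rfl⟩ := Nat.exists_eq_add_of_le ((le_max_right _ _).trans hn)
  have hruns : ∀ t, 2 * (c : ℝ) * ((u.length + k : ℕ) : ℝ) < letterRuns (W t k) := fun t =>
    hN _ ((le_max_left _ _).trans hn) _ (hlen t k) (mem_straddledValues_of_isMixed hr (hWm t k))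
  let B : ℤ × ℤ → Set ℝ := fun p => {t | t ∈ φ ⁻¹' s ∩ Set.Ico 0 1 ∧
    latticeCoord 1 (W t k) - latticeCoord 1 (W t₀ k) = p.1 ∧
    latticeCoord 2 (W t k) - latticeCoord 2 (W t₀ k) = p.2}
  let Q : Finset (ℤ × ℤ) := Finset.Icc (-3) 3 ×ˢ Finset.Icc (-3) 3
  have hhalf : ENNReal.ofReal (1 / 2 : ℝ) = 1 / 2 := by
    rw [ENNReal.ofReal_div_of_pos (by norm_num)]
    simp
  have hcov : φ ⁻¹' s ∩ Set.Ico 0 1 ⊆ ⋃ p ∈ Q, B p := by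
    intro t ht
    have hd : dist (φ t) (φ t₀) ≤ (1 / 2 : ℝ) ^ (W t k).length := by
      have h1 := (edist_le_ediam_of_mem (show φ t ∈ s from ht.1) ht₀).trans hs
      rw [hlen, ← ENNReal.ofReal_le_ofReal_iff (by positivity), ← edist_dist,
        ENNReal.ofReal_pow (by norm_num), hhalf]
      exact h1
    obtain ⟨h2, h3⟩ := abs_latticeCoord_sub_le hv ((hlen t k).trans (hlen t₀ k).symm) (hφW t k)
      (hφW t₀ k) hd
    refine Set.mem_iUnion₂.2 ⟨(_, _), ?_, ht, rfl, rfl⟩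
    rw [Finset.mem_product, Finset.mem_Icc, Finset.mem_Icc]
    exact ⟨abs_le.1 h2, abs_le.1 h3⟩
  have hBvol : ∀ p ∈ Q, volume (B p) ≤
      ENNReal.ofReal (A * ((1 / 2 : ℝ) ^ (u.length + k)) ^ (c : ℝ)) := by
    intro p _
    refine volume_setOf_mem_word_le hWd hruns (fun t ht => ht.1.2) fun t ht t' ht' => ?_
    refine eq_of_latticeCoord_eq ((hlen t k).trans (hlen t' k).symm) ?_ ?_
    · linarith [ht.2.1, ht'.2.1]
    · linarith [ht.2.2, ht'.2.2]
  have hQ : Q.card = 49 := by decide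
  clear_value A
  calc volume (φ ⁻¹' s ∩ Set.Ico 0 1) ≤ ∑ p ∈ Q, volume (B p) :=
        (measure_mono hcov).trans (measure_biUnion_finset_le _ _)
    _ ≤ ∑ _p ∈ Q, ENNReal.ofReal (A * ((1 / 2 : ℝ) ^ (u.length + k)) ^ (c : ℝ)) :=
        Finset.sum_le_sum hBvol
    _ = 49 * ENNReal.ofReal (A * ((1 / 2 : ℝ) ^ (u.length + k)) ^ (c : ℝ)) := by
        rw [Finset.sum_const, hQ, nsmul_eq_mul]
        rfl
    _ = _ := by
        rw [ENNReal.ofReal_mul hA0, ← ENNReal.ofReal_rpow_of_pos (by positivity),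
          ENNReal.ofReal_pow (by norm_num), hhalf, ENNReal.coe_mul, mul_assoc]
        rfl

/-- Without a mixed triangle the colour passes from parent to child through the shared corner, so
all vertices lie on one side of `r`; by density `r` is then an extremum of `F`. Vertex values are
countable and the extrema are at most two, hence null. -/
theorem ae_exists_isMixed (hv : ∀ i j, i ≠ j → dist (v i) (v j) = 1) (hα : 0 < α)
    (hF : HolderOnWith 1 α F (sierpinskiTriangle v)) :
    ∀ᵐ r : ℝ, r ∈ F '' sierpinskiTriangle v →
      (∀ w i, F (wordTriangle v w i) ≠ r) ∧ ∃ u, IsMixed (sideColouring v F r u) := by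
  have hvert : ∀ᵐ r : ℝ, ∀ w i, F (wordTriangle v w i) ≠ r := by
    rw [ae_all_iff]
    intro w
    rw [ae_all_iff]
    intro i
    refine measure_mono_null (t := {F (wordTriangle v w i)}) (fun r hr => ?_) (by simp)
    simpa [eq_comm] using hr
  have hext : ∀ G : EuclideanSpace ℝ (Fin 2) → ℝ, ∀ᵐ r : ℝ,
      ¬ IsGreatest (G '' sierpinskiTriangle v) r := by
    intro G
    have hsub : {r | IsGreatest (G '' sierpinskiTriangle v) r}.Subsingleton :=
      fun r hr r' hr' => hr.unique hr'
    refine measure_mono_null (fun r hr => ?_) (hsub.measure_zero volume)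
    simpa using hr
  have hmin : ∀ᵐ r : ℝ, ¬ IsLeast (F '' sierpinskiTriangle v) r := by
    have hsub : {r | IsLeast (F '' sierpinskiTriangle v) r}.Subsingleton :=
      fun r hr r' hr' => hr.unique hr'
    refine measure_mono_null (fun r hr => ?_) (hsub.measure_zero volume)
    simpa using hr
  filter_upwards [hvert, hext F, hmin] with r hr hmax hmin hrF
  refine ⟨hr, ?_⟩
  by_contra! hno
  have hmono : ∀ w i j, sideColouring v F r w i = sideColouring v F r w j := by
    intro w i j
    by_contra h
    exact hno w ⟨i, j, h⟩
  have hall : ∀ w i, sideColouring v F r w i = sideColouring v F r [] 0 := by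
    intro w
    induction w with
    | nil => exact fun i => hmono _ _ _
    | cons k w ih =>
      intro i
      rw [hmono _ i k, sideColouring_cons_self, ih]
  cases h : sideColouring v F r [] 0
  · refine hmin ⟨hrF, ?_⟩
    rintro _ ⟨x, hx, rfl⟩
    refine neg_le_neg_iff.1 (le_of_forall_wordTriangle_le hv hα hF.neg (fun w i => ?_) hx)
    have := (hall w i).trans h
    simp only [sideColouring, decide_eq_false_iff_not, not_lt] at this
    exact neg_le_neg this
  · refine hmax ⟨hrF, ?_⟩
    rintro _ ⟨x, hx, rfl⟩
    refine le_of_forall_wordTriangle_le hv hα hF (fun w i => ?_) hx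
    have := (hall w i).trans h
    simp only [sideColouring, decide_eq_true_eq] at this
    exact this.le

end LevelSets

/-! ### The constant in the dimension bound. -/

section Numerics

theorem levelSetDim_denominator_pos {a : ℝ} (ha : 0 < a) (ha1 : a ≤ 1) :
    0 < 1 + (1 + Real.log (3 / a)) / Real.log 2 + 2 / a := by
  have h1 : 0 ≤ Real.log (3 / a) := Real.log_nonneg (by rw [le_div_iff₀ ha]; linarith)
  have h2 : 0 < Real.log 2 := Real.log_pos (by norm_num)
  positivity

/-- The run weight is chosen as `y = a / 8`. In logarithms the first factor contributes at most `a /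
4`, the second at most `0.6 a log 2`, and `1 / 4 + 0.6 log 2 < log 2`. -/
theorem entropy_estimate {a : ℝ} (ha : 0 < a) (ha1 : a ≤ 1) :
    (1 + 2 * (a / 8)) * (a / 8) ^
      (-(2 * (a / 2 / (1 + (1 + Real.log (3 / a)) / Real.log 2 + 2 / a)))) *
      (1 / 2 : ℝ) ^ a < 1 := by
  set D : ℝ := 1 + (1 + Real.log (3 / a)) / Real.log 2 + 2 / a with hD
  have hD0 : 0 < D := levelSetDim_denominator_pos ha ha1
  have hl : 0 < Real.log 2 := Real.log_pos (by norm_num)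
  have hl1 := Real.log_two_gt_d9
  have hl2 := Real.log_two_lt_d9
  have hl3 : 1 < Real.log 3 := by
    rw [Real.lt_log_iff_exp_lt (by norm_num)]
    exact Real.exp_one_lt_d9.trans (by norm_num)
  have hinv : 1 ≤ 1 / a := by rw [le_div_iff₀ ha]; linarith
  have hL : Real.log (1 / a) ≤ 1 / a - 1 := Real.log_le_sub_one_of_pos (by positivity)
  have hL0 : 0 ≤ Real.log (1 / a) := Real.log_nonneg hinv
  have e3 : Real.log (3 / a) = Real.log 3 + Real.log (1 / a) := by
    rw [← Real.log_mul (by norm_num) (by positivity)]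
    ring_nf
  have e8 : Real.log (a / 8) = -(3 * Real.log 2 + Real.log (1 / a)) := by
    have : (8 : ℝ) = 2 ^ 3 := by norm_num
    rw [Real.log_div ha.ne' (by norm_num), this, Real.log_pow, one_div, Real.log_inv]
    push_cast
    ring
  have ehalf : Real.log (1 / 2) = -Real.log 2 := by rw [one_div, Real.log_inv]
  have hDl : D * Real.log 2 = Real.log 2 + 1 + Real.log 3 + Real.log (1 / a) +
      2 * Real.log 2 * (1 / a) := by
    rw [hD, e3]
    field_simp
    ring
  have hmain : 3 * Real.log 2 + Real.log (1 / a) ≤ 0.6 * (D * Real.log 2) := by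
    rw [hDl]
    nlinarith
  have hpos : 0 < (1 + 2 * (a / 8)) * (a / 8) ^ (-(2 * (a / 2 / D))) * (1 / 2 : ℝ) ^ a := by
    positivity
  rw [← Real.log_neg_iff hpos, Real.log_mul (by positivity) (by positivity),
    Real.log_mul (by positivity) (by positivity), Real.log_rpow (by positivity),
    Real.log_rpow (by norm_num), e8, ehalf]
  have h1 : Real.log (1 + 2 * (a / 8)) ≤ a / 4 := by
    have := Real.log_le_sub_one_of_pos (show 0 < 1 + 2 * (a / 8) by positivity)
    linarith
  have h2 : -(2 * (a / 2 / D)) * -(3 * Real.log 2 + Real.log (1 / a)) ≤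
      a * (0.6 * Real.log 2) := by
    have h3 : -(2 * (a / 2 / D)) * -(3 * Real.log 2 + Real.log (1 / a)) =
        a * ((3 * Real.log 2 + Real.log (1 / a)) / D) := by ring
    rw [h3]
    refine mul_le_mul_of_nonneg_left ?_ ha.le
    rw [div_le_iff₀ hD0]
    linarith
  nlinarith

end Numerics

theorem theorem3p2 (v : Fin 3 → EuclideanSpace ℝ (Fin 2))
    (hv : ∀ i j, i ≠ j → dist (v i) (v j) = 1)
    (α : ℝ≥0) (hα₀ : 0 < α) (hα₁ : α ≤ 1)
    (f : sierpinskiTriangle v → ℝ) (hf : HolderWith 1 α f) :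
    (∀ᵐ r : ℝ ∂MeasureTheory.volume, r ∈ Set.range f →
      ENNReal.ofReal (((α : ℝ) / 2) /
          (1 + (1 + Real.log (3 / (α : ℝ))) / Real.log 2 + 2 / (α : ℝ))) ≤
        dimH (Subtype.val '' (f ⁻¹' {r}) : Set (EuclideanSpace ℝ (Fin 2)))) ∧
    0 < ((α : ℝ) / 2) /
          (1 + (1 + Real.log (3 / (α : ℝ))) / Real.log 2 + 2 / (α : ℝ)) := by
  have hα : (0 : ℝ) < α := hα₀
  have hα' : (α : ℝ) ≤ 1 := hα₁
  set c : ℝ := ((α : ℝ) / 2) / (1 + (1 + Real.log (3 / (α : ℝ))) / Real.log 2 + 2 / (α : ℝ))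
    with hcdef
  have hc : 0 < c := div_pos (by positivity) (levelSetDim_denominator_pos hα hα')
  refine ⟨?_, hc⟩
  -- The zero extension is only a convenience: the Hölder bound and the level set involve `F` only
  -- on the Sierpiński triangle.
  let F : EuclideanSpace ℝ (Fin 2) → ℝ := Function.extend Subtype.val f 0
  have hFf : ∀ x : sierpinskiTriangle v, F x = f x := fun x =>
    Subtype.val_injective.extend_apply f 0 x
  have hF : HolderOnWith 1 α F (sierpinskiTriangle v) := by
    intro x hx y hy
    have h := hf ⟨x, hx⟩ ⟨y, hy⟩
    rw [← hFf, ← hFf] at h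
    exact h
  filter_upwards [ae_exists_isMixed hv hα₀ hF, ae_eventually_lt_letterRuns hv hF
    (by positivity) (by linarith) (entropy_estimate hα hα')] with r hr1 hr2 hr
  obtain ⟨x, rfl⟩ := hr
  obtain ⟨hvert, u, hu⟩ := hr1 ⟨x, x.2, hFf x⟩
  have hcc : ((c.toNNReal : ℝ≥0) : ℝ) = c := Real.coe_toNNReal c hc.le
  refine (le_dimH_level_set hv hα₀ hF hvert hu (Real.toNNReal_pos.2 hc) ?_).trans
    (dimH_mono ?_)
  · rw [hcc]
    exact hr2
  · rintro z ⟨hz, hzr⟩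
    exact ⟨⟨z, hz⟩, (hFf ⟨z, hz⟩).symm.trans hzr, rfl⟩
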